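/- Let $K$ be a connected oriented classical link diagram (a non-empty diagram of an oriented link whose image in the plane is connected; a single circle without crossings is allowed). Let $c(K)$ be its number of crossings, $\mu(K)$ the number of components of the link, and $s(K)$ the number of its Seifert circles, that is, of the closed curves that remain if every crossing is smoothed in the way that respects the orientation. Let $F(K)$ be the Seifert surface of the diagram: the compact oriented surface formed from $s(K)$ disjoint discs, one with boundary each Seifert circle, by joining these discs with one half-twisted band at each smoothed crossing. Let $g(F(K))$ be its genus, that is, one half of the rank of the first homology group of the closed surface obtained from $F(K)$ by gluing a disc to each boundary component. Then $$g(F(K)) = \tfrac12\bigl(c(K) - s(K) + 1 - (\mu(K) - 1)\bigr).$$ -/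

import Mathlib

/-- The cycles of a permutation; fixed points count as cycles of length one. -/
abbrev PermCycles {α : Type*} (σ : Equiv.Perm α) : Type _ :=
  Quotient (Equiv.Perm.SameCycle.setoid σ)

/-- The combinatorial data of an oriented link diagram with finitely many crossings.

Draw every crossing with both strands pointing up.  It has two incoming ends, at the bottom, and
two outgoing ends, at the top; each of the two pairs is labelled by `false` (left) and `true`
(right).  The two strands run from the lower left to the upper right, and from the lower right to
the upper left.  `edge` sends the outgoing end at which an edge of the diagram starts to the
incoming end at which this edge ends, so that `Crossing × Bool` indexes the edges as well.

`positive x` holds if the strand of `x` from the lower left to the upper right is the upper one,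
that is, if `x` is a positive crossing.

`Circle` is the set of the closed curves of the diagram that pass through no crossing.  The
position of the split pieces of the diagram relative to each other is not recorded. -/
structure DiagramData where
  Crossing : Type
  [crossingFintype : Fintype Crossing]
  edge : Equiv.Perm (Crossing × Bool)
  positive : Crossing → Prop
  Circle : Type
  [circleFintype : Fintype Circle]

attribute [instance] DiagramData.crossingFintype DiagramData.circleFintype

namespace DiagramData

variable (D : DiagramData)

/-- The arcs of a diagram: its edges from crossing to crossing, each named by the outgoing end where
it starts, and its closed curves without crossings. -/
abbrev Arc : Type := (D.Crossing × Bool) ⊕ D.Circle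

/-- Interchange left and right at every crossing. -/
def swapSides : Equiv.Perm (D.Crossing × Bool) where
  toFun p := (p.1, !p.2)
  invFun p := (p.1, !p.2)
  left_inv p := by simp
  right_inv p := by simp

/-- The arc that follows a given arc on the link: go straight on at the crossing (an incoming
strand on the left leaves on the right, and conversely). -/
def linkNext : Equiv.Perm D.Arc :=
  Equiv.sumCongr (D.edge.trans D.swapSides) (Equiv.refl D.Circle)

/-- The arc that follows a given arc after the smoothing of all crossings in the oriented manner
(an incoming strand on the left leaves on the left, and one on the right leaves on the right). -/
def smoothNext : Equiv.Perm D.Arc :=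
  Equiv.sumCongr D.edge (Equiv.refl D.Circle)

/-- The components of the link. -/
abbrev Component : Type := PermCycles D.linkNext

/-- The Seifert circles of the diagram. -/
abbrev SeifertCircle : Type := PermCycles D.smoothNext

/-- The number `c` of crossings. -/
noncomputable def numCrossings : ℕ := Nat.card D.Crossing

/-- The number `s` of Seifert circles. -/
noncomputable def numSeifertCircles : ℕ := Nat.card D.SeifertCircle

/-- The number `μ` of components of the link. -/
noncomputable def numComponents : ℕ := Nat.card D.Component

/-- The connected components of the underlying 4-valent graph of the crossings and edges. -/
abbrev GraphPiece : Type :=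
  Quot fun x y : D.Crossing => ∃ a b : Bool, D.edge (x, a) = (y, b)

/-- The connected components of the diagram, as a subset of the plane. -/
abbrev Piece : Type := D.GraphPiece ⊕ D.Circle

/-- The diagram is connected as a subset of the plane: it is not empty and has only one piece. -/
def IsConnected : Prop := Nat.card D.Piece = 1

/-- The half-edges at the crossings: `inl p` is the outgoing end `p`, `inr p` the incoming end. -/
abbrev HalfEdge : Type := (D.Crossing × Bool) ⊕ (D.Crossing × Bool)

/-- The other half of the same edge. -/
def opposite : Equiv.Perm D.HalfEdge where
  toFun
    | Sum.inl p => Sum.inr (D.edge p)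
    | Sum.inr p => Sum.inl (D.edge.symm p)
  invFun
    | Sum.inl p => Sum.inr (D.edge p)
    | Sum.inr p => Sum.inl (D.edge.symm p)
  left_inv p := by rcases p with p | p <;> simp
  right_inv p := by rcases p with p | p <;> simp

/-- The next half-edge at the same crossing, counterclockwise: lower left, lower right, upper
right, upper left. -/
def rotate : Equiv.Perm D.HalfEdge where
  toFun
    | Sum.inr (x, false) => Sum.inr (x, true)
    | Sum.inr (x, true) => Sum.inl (x, true)
    | Sum.inl (x, true) => Sum.inl (x, false)
    | Sum.inl (x, false) => Sum.inr (x, false)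
  invFun
    | Sum.inr (x, true) => Sum.inr (x, false)
    | Sum.inl (x, true) => Sum.inr (x, true)
    | Sum.inl (x, false) => Sum.inl (x, true)
    | Sum.inr (x, false) => Sum.inl (x, false)
  left_inv p := by rcases p with ⟨x, _ | _⟩ | ⟨x, _ | _⟩ <;> rfl
  right_inv p := by rcases p with ⟨x, _ | _⟩ | ⟨x, _ | _⟩ <;> rfl

/-- The regions of the rotation system, listed separately for every piece of the graph. -/
abbrev Region : Type := PermCycles (D.opposite.trans D.rotate)

/-- The rotation system is planar: every piece of the graph has Euler characteristic
`V - E + F = 2`.  (No piece has more than 2, there are `c` vertices and `2 c` edges, hence it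
suffices to ask for the sum over all pieces.) -/
def IsPlanar : Prop :=
  Nat.card D.Region = Nat.card D.Crossing + 2 * Nat.card D.GraphPiece

end DiagramData

/-- A classical oriented link diagram: the underlying 4-valent graph is drawn in the plane. -/
structure LinkDiagram extends DiagramData where
  planar : toDiagramData.IsPlanar

/-- A compact oriented surface, with or without boundary, presented by the gluing of polygons.
`Side` is the set of all sides of finitely many disjoint oriented polygons (discs); `next` sends a
side to the one that follows it on the boundary of its polygon, so that the polygons are the
cycles of `next`.  A side `x` with `glue x ≠ x` is glued to the side `glue x`, with the direction
reversed; a side with `glue x = x` is not glued to anything and lies on the boundary. -/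
structure PolygonSurface where
  Side : Type
  [sideFintype : Fintype Side]
  next : Equiv.Perm Side
  glue : Side → Side
  glue_glue : ∀ x, glue (glue x) = x

attribute [instance] PolygonSurface.sideFintype

namespace PolygonSurface

variable (P : PolygonSurface)

/-- The polygons. -/
abbrev Polygon : Type := PermCycles P.next

/-- The polygon to which a side belongs. -/
def polygonOf (x : P.Side) : P.Polygon := Quotient.mk _ x

/-- The vertices of the glued surface.  Every corner of a polygon is named by the side that starts
there; the starting point of a glued side `x` is identified with the end point of `glue x`. -/
abbrev Vertex : Type :=
  Quot fun x y : P.Side => P.glue x ≠ x ∧ y = P.next (P.glue x)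

/-- The starting point of a side. -/
def start (x : P.Side) : P.Vertex := Quot.mk _ x

/-- The end point of a side. -/
def finish (x : P.Side) : P.Vertex := P.start (P.next x)

/-- The sides that lie on the boundary. -/
abbrev FreeSide : Type := {x : P.Side // P.glue x = x}

/-- The boundary components: boundary sides are linked if one of them starts where the other
one ends. -/
abbrev BoundaryComponent : Type :=
  Quot fun x y : P.FreeSide => P.finish x.1 = P.start y.1

/-- The boundary component to which a boundary side belongs. -/
def boundaryOf (x : P.FreeSide) : P.BoundaryComponent := Quot.mk _ x

/-- The relations between the sides, as 1-chains: two sides that are glued to each other are the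
same edge of the surface with opposite directions. -/
noncomputable def glueRelations : Submodule ℚ (P.Side →₀ ℚ) :=
  Submodule.span ℚ {v | ∃ x, P.glue x ≠ x ∧
    v = Finsupp.single x 1 + Finsupp.single (P.glue x) 1}

/-- The cellular 1-chains of the glued surface, with rational coefficients. -/
abbrev EdgeChains : Type := (P.Side →₀ ℚ) ⧸ P.glueRelations

/-- The 1-chain of a side. -/
noncomputable def edgeChain (x : P.Side) : P.EdgeChains :=
  P.glueRelations.mkQ (Finsupp.single x 1)

/-- End point minus starting point, on the free module on the sides. -/
noncomputable def sideBoundary : (P.Side →₀ ℚ) →ₗ[ℚ] (P.Vertex →₀ ℚ) :=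
  Finsupp.linearCombination ℚ fun x =>
    Finsupp.single (P.finish x) (1 : ℚ) - Finsupp.single (P.start x) 1

theorem start_eq_finish_glue (x : P.Side) (hx : P.glue x ≠ x) :
    P.start x = P.finish (P.glue x) :=
  Quot.sound ⟨hx, rfl⟩

theorem glueRelations_le_ker : P.glueRelations ≤ LinearMap.ker P.sideBoundary := by
  refine Submodule.span_le.2 ?_
  rintro v ⟨x, hx, rfl⟩
  have h1 := P.start_eq_finish_glue x hx
  have h2 := P.start_eq_finish_glue (P.glue x) (by rw [P.glue_glue]; exact fun h => hx h.symm)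
  rw [P.glue_glue] at h2
  simp [sideBoundary, h1, h2]

/-- The cellular boundary map from 1-chains to 0-chains. -/
noncomputable def boundaryOne : P.EdgeChains →ₗ[ℚ] (P.Vertex →₀ ℚ) :=
  P.glueRelations.liftQ P.sideBoundary P.glueRelations_le_ker

/-- The 2-cells of the closed surface that arises if a disc is glued to every boundary component:
the polygons and these discs. -/
abbrev CappedFace : Type := P.Polygon ⊕ P.BoundaryComponent

open Classical in
/-- The boundary of a 2-cell of the capped surface: the sum of the sides of a polygon, or minus the
sum of the sides of a boundary component. -/
noncomputable def faceBoundary : P.CappedFace → P.EdgeChains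
  | Sum.inl f => ∑ x : P.Side with P.polygonOf x = f, P.edgeChain x
  | Sum.inr b => -∑ x : P.FreeSide with P.boundaryOf x = b, P.edgeChain x.1

/-- The cellular boundary map of the capped surface from 2-chains to 1-chains. -/
noncomputable def cappedBoundaryTwo : (P.CappedFace →₀ ℚ) →ₗ[ℚ] P.EdgeChains :=
  Finsupp.linearCombination ℚ P.faceBoundary

/-- The first rational homology of the capped surface: the 1-cycles modulo the boundaries of the
2-chains.  (Capping does not change the vertices and edges.) -/
abbrev CappedHomologyOne : Type :=
  LinearMap.ker P.boundaryOne ⧸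
    (LinearMap.range P.cappedBoundaryTwo).submoduleOf (LinearMap.ker P.boundaryOne)

/-- The genus: one half of the rank of the first homology of the closed oriented surface that
arises if a disc is glued to every boundary component. -/
noncomputable def genus : ℕ := Module.finrank ℚ P.CappedHomologyOne / 2

end PolygonSurface

namespace DiagramData

variable (D : DiagramData)

/-- The sides of the polygons from which the Seifert surface is assembled.

* `arc a` is the arc `a` of the diagram, on the boundary of the disc that is attached to the
  Seifert circle through `a`.
* `smoothing (x, b)` is the short arc of this Seifert circle at the smoothed crossing `x` from its
  incoming end `b` to its outgoing end `b`, as a side of the same disc.  A band is attached there.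
* `bandEnd (x, b)` is the side of the band at `x` that is attached to `smoothing (x, b)`.
* `strand (x, b)` is the side of the band at `x` that follows the strand of the link from the
  incoming end `b` to the outgoing end `!b`. -/
inductive SeifertSide : Type
  | arc (a : D.Arc)
  | smoothing (p : D.Crossing × Bool)
  | bandEnd (p : D.Crossing × Bool)
  | strand (p : D.Crossing × Bool)

namespace SeifertSide

variable {D}

/-- The sides as a disjoint union. -/
def toSum : D.SeifertSide →
    D.Arc ⊕ (D.Crossing × Bool) ⊕ (D.Crossing × Bool) ⊕ (D.Crossing × Bool)
  | arc a => Sum.inl a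
  | smoothing p => Sum.inr (Sum.inl p)
  | bandEnd p => Sum.inr (Sum.inr (Sum.inl p))
  | strand p => Sum.inr (Sum.inr (Sum.inr p))

theorem toSum_injective : Function.Injective (toSum (D := D)) := by
  intro x y h
  cases x <;> cases y <;> simp_all [toSum]

noncomputable instance : Fintype D.SeifertSide := Fintype.ofInjective toSum toSum_injective

/-- The order of the sides along the polygons.  The boundary of a disc is its Seifert circle, and
every crossing contributes to it the arc of the smoothing.  The band at a crossing is a rectangle
with a half twist: it is attached to the smoothing arcs on the left and on the right, and each of
its other two sides leads from the incoming end of one of them to the outgoing end of the other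
one, along a strand of the link.  (The sense of the half twist, which is given by the sign of the
crossing, affects only the position of the surface in space.) -/
def next : Equiv.Perm D.SeifertSide where
  toFun
    | arc (Sum.inl p) => smoothing (D.edge p)
    | arc (Sum.inr o) => arc (Sum.inr o)
    | smoothing p => arc (Sum.inl p)
    | bandEnd p => strand p
    | strand p => bandEnd (D.swapSides p)
  invFun
    | smoothing p => arc (Sum.inl (D.edge.symm p))
    | arc (Sum.inr o) => arc (Sum.inr o)
    | arc (Sum.inl p) => smoothing p
    | strand p => bandEnd p
    | bandEnd p => strand (D.swapSides.symm p)
  left_inv x := by rcases x with (p | o) | p | p | p <;> simp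
  right_inv x := by rcases x with (p | o) | p | p | p <;> simp

/-- The bands are glued to the discs along the smoothing arcs; all other sides are free. -/
def glue : D.SeifertSide → D.SeifertSide
  | arc a => arc a
  | smoothing p => bandEnd p
  | bandEnd p => smoothing p
  | strand p => strand p

end SeifertSide

/-- The Seifert surface of the diagram: one disc for every Seifert circle, with the orientation for
which the Seifert circle is its oriented boundary, and one half-twisted band for every crossing. -/
noncomputable def seifertSurface : PolygonSurface where
  Side := D.SeifertSide
  next := SeifertSide.next
  glue := SeifertSide.glue
  glue_glue x := by cases x <;> rfl

end DiagramData

/-! The genus comes from the Euler characteristic of the capped Seifert surface. Let `o` be the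
number of circles without crossings. The cell structure has `4c + o` vertices (the ends of the
crossings, and one point on each such circle), `6c + o` edges (arcs, smoothing arcs and strands) and
`s + c + μ` faces (discs, bands and caps). Its Euler characteristic is therefore `s + μ - c`, and
for a connected closed oriented surface the first homology has rank `2 - χ = c + 2 - s - μ`.

The relation between rank and `χ` is linear algebra on the cellular chain complex. The boundary map
on 1-chains has corank one (`finrank_range_boundaryOne`), the one on 2-chains has nullity one
(`finrank_range_cappedBoundaryTwo`), and their composite is zero. Both ranks use connectedness in
the form that an invariant function on the sides is constant: first for vertex classes modulo
boundaries, then for the coefficients of a 2-cycle.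

Since `genus` is defined by a division in `ℕ`, the rank must be shown to be even. The permutation
that follows the link is the one that follows the Seifert circles, composed with one transposition
per crossing. Comparing signs gives `μ ≡ s + c` modulo 2 (`even_numComponents_add`). -/

namespace PermCycles

/-! ### Cycles and sign of a permutation -/

theorem apply_eq_of_sameCycle {α M : Type*} {σ : Equiv.Perm α} {f : α → M}
    (hf : ∀ x, f (σ x) = f x) {x y : α} (h : σ.SameCycle x y) : f x = f y := by
  have hpow : ∀ (n : ℕ) z, f ((σ ^ n) z) = f z := by
    intro n
    induction n with
    | zero => simp
    | succ n ih => intro z; rw [pow_succ', Equiv.Perm.mul_apply, hf, ih]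
  obtain ⟨i, rfl⟩ := h
  obtain ⟨n, rfl | rfl⟩ := i.eq_nat_or_neg
  · rw [zpow_natCast, hpow]
  · rw [zpow_neg, zpow_natCast, ← hpow n ((σ ^ n)⁻¹ x), ← Equiv.Perm.mul_apply, mul_inv_cancel,
      Equiv.Perm.one_apply]

/-- A function that is invariant under a permutation, as a function on its cycles. -/
def lift {α M : Type*} {σ : Equiv.Perm α} (f : α → M) (hf : ∀ x, f (σ x) = f x) :
    PermCycles σ → M :=
  Quotient.lift f fun _ _ h => apply_eq_of_sameCycle hf h

theorem mk_apply {α : Type*} (σ : Equiv.Perm α) (x : α) :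
    (Quotient.mk _ (σ x) : PermCycles σ) = Quotient.mk _ x :=
  Quotient.sound (Equiv.Perm.sameCycle_apply_left.2 (Equiv.Perm.SameCycle.refl σ x))

/-- The cycles of a permutation are its fixed points and its cycle factors. -/
theorem card_eq {α : Type*} [Fintype α] [DecidableEq α] (σ : Equiv.Perm α) :
    Nat.card (PermCycles σ) =
      Fintype.card (Function.fixedPoints σ) + σ.cycleFactorsFinset.card := by
  let g : α → Function.fixedPoints σ ⊕ σ.cycleFactorsFinset := fun x =>
    if h : σ x = x then Sum.inl ⟨x, h⟩ else
      Sum.inr ⟨σ.cycleOf x, by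
        rw [Equiv.Perm.cycleOf_mem_cycleFactorsFinset_iff, Equiv.Perm.mem_support]; exact h⟩
  have hg : ∀ x, g (σ x) = g x := by
    intro x
    by_cases h : σ x = x
    · rw [h]
    · have h' : σ (σ x) ≠ σ x := fun e => h (σ.injective e)
      simp only [g, h, h', dif_neg, not_false_eq_true, Sum.inr.injEq, Subtype.mk.injEq]
      exact (Equiv.Perm.SameCycle.cycleOf_eq
        (Equiv.Perm.sameCycle_apply_right.2 (Equiv.Perm.SameCycle.refl σ x))).symm
  have hbij : Function.Bijective (lift g hg) := by
    constructor
    · rintro ⟨x⟩ ⟨y⟩ (h : g x = g y)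
      by_cases hx : σ x = x <;> by_cases hy : σ y = y <;> simp only [g, hx, hy, dite_true,
        dite_false, Sum.inl.injEq, Sum.inr.injEq, Subtype.mk.injEq, reduceCtorEq] at h
      · exact congrArg (Quotient.mk _) (congrArg Subtype.val h)
      · refine Quotient.sound ?_
        exact (Equiv.Perm.sameCycle_iff_cycleOf_eq_of_mem_support
          (Equiv.Perm.mem_support.2 hx) (Equiv.Perm.mem_support.2 hy)).2 h
    · rintro (⟨x, hx⟩ | ⟨c, hc⟩)
      · refine ⟨Quotient.mk _ x, ?_⟩
        have hx' : σ x = x := hx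
        simp [lift, g, hx']
      · have hcyc := (Equiv.Perm.mem_cycleFactorsFinset_iff.1 hc).1
        obtain ⟨x, hx, -⟩ := id hcyc
        have hxs : x ∈ c.support := Equiv.Perm.mem_support.2 hx
        have hσx : σ x ≠ x := by
          rw [← (Equiv.Perm.mem_cycleFactorsFinset_iff.1 hc).2 x hxs]; exact hx
        refine ⟨Quotient.mk _ x, ?_⟩
        simp only [lift, g, Quotient.lift_mk, hσx, dite_false, Sum.inr.injEq, Subtype.mk.injEq]
        exact (Equiv.Perm.cycle_is_cycleOf hxs hc).symm
  rw [Nat.card_congr (Equiv.ofBijective _ hbij), Nat.card_sum, Nat.card_eq_fintype_card,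
    Nat.card_eq_fintype_card, Fintype.card_coe]

/-- The sign of a permutation, in terms of its number of cycles. -/
theorem sign_eq {α : Type*} [Fintype α] [DecidableEq α] (σ : Equiv.Perm α) :
    Equiv.Perm.sign σ = (-1) ^ (Fintype.card α + Nat.card (PermCycles σ)) := by
  have h1 := card_eq σ
  have h2 := Equiv.Perm.card_fixedPoints σ
  have h3 := σ.sum_cycleType_le
  have h4 : σ.cycleType.card = σ.cycleFactorsFinset.card := by
    simp [Equiv.Perm.cycleType_def]
  rw [Equiv.Perm.sign_of_cycleType, h1, h4]
  -- The cycle type omits fixed points, so its sum is the number of moved points; the two exponents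
  -- differ by twice the number of fixed points.
  have h5 : Fintype.card α + (Fintype.card (Function.fixedPoints σ) + σ.cycleFactorsFinset.card)
      = σ.cycleType.sum + σ.cycleFactorsFinset.card
        + 2 * Fintype.card (Function.fixedPoints σ) := by omega
  rw [h5, pow_add _ _ (2 * _), pow_mul, Int.units_sq, one_pow, mul_one]

end PermCycles

/-! ### Euler characteristic of a connected capped polygon surface -/

namespace PolygonSurface

variable (P : PolygonSurface)

/-- The polygons of the surface are connected with each other: a function on the sides that is
constant along every polygon and across every gluing is constant. -/
def IsConnected : Prop :=
  ∀ (M : Type) (h : P.Side → M), (∀ x, h (P.next x) = h x) → (∀ x, h (P.glue x) = h x) →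
    ∀ x y, h x = h y

theorem finrank_finsupp_eq_natCard (ι : Type) [Finite ι] :
    Module.finrank ℚ (ι →₀ ℚ) = Nat.card ι := by
  have := Fintype.ofFinite ι
  rw [Module.finrank_finsupp_self, Nat.card_eq_fintype_card]

variable {P}

/-- This is `H₀ = ℚ`: on a connected surface the 0-boundaries are exactly the kernel of the
augmentation, a hyperplane. -/
theorem finrank_range_boundaryOne (hP : P.IsConnected) [Nonempty P.Side] :
    Module.finrank ℚ (LinearMap.range P.boundaryOne) + 1 = Nat.card P.Vertex := by
  obtain ⟨x₀⟩ := ‹Nonempty P.Side›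
  let aug : (P.Vertex →₀ ℚ) →ₗ[ℚ] ℚ := Finsupp.linearCombination ℚ fun _ => (1 : ℚ)
  have hrange : LinearMap.range P.boundaryOne = LinearMap.range P.sideBoundary := by
    rw [boundaryOne, Submodule.range_liftQ]
  have hker : LinearMap.range P.sideBoundary = LinearMap.ker aug := by
    apply le_antisymm
    · rw [LinearMap.range_le_ker_iff]
      ext x
      simp [aug, sideBoundary]
    · intro f hf
      let S := LinearMap.range P.sideBoundary
      -- Modulo boundaries the two end points of a side agree, so connectedness makes all vertex
      -- classes equal and the quotient map factors through `aug`.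
      let q : P.Vertex → (P.Vertex →₀ ℚ) ⧸ S := fun v => S.mkQ (Finsupp.single v 1)
      have hq : ∀ x, q (P.finish x) = q (P.start x) := by
        intro x
        refine (Submodule.Quotient.eq S).2 ⟨Finsupp.single x 1, ?_⟩
        simp [sideBoundary]
      have hconst : ∀ v, q v = q (P.start x₀) := by
        rintro ⟨x⟩
        refine hP _ (fun x => q (P.start x)) hq (fun x => ?_) x x₀
        by_cases hx : P.glue x = x
        · rw [hx]
        · rw [P.start_eq_finish_glue x hx, hq]
      have hlin : S.mkQ = (LinearMap.toSpanSingleton ℚ _ (q (P.start x₀))).comp aug := by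
        ext v
        rw [LinearMap.comp_apply, LinearMap.comp_apply, LinearMap.comp_apply, Finsupp.lsingle_apply,
          Finsupp.linearCombination_single, smul_eq_mul, mul_one, LinearMap.toSpanSingleton_apply,
          one_smul]
        exact hconst v
      have : S.mkQ f = 0 := by
        rw [hlin, LinearMap.comp_apply, LinearMap.mem_ker.1 hf, map_zero]
      exact (Submodule.Quotient.mk_eq_zero S).1 this
  have hsurj : LinearMap.range aug = ⊤ := by
    refine LinearMap.range_eq_top.2 fun r => ⟨Finsupp.single (P.start x₀) r, ?_⟩
    simp [aug]
  have h := LinearMap.finrank_range_add_finrank_ker aug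
  rw [hsurj, finrank_top, Module.finrank_self, finrank_finsupp_eq_natCard] at h
  rw [hrange, hker]
  omega

theorem edgeChain_glue (x : P.Side) (hx : P.glue x ≠ x) :
    P.edgeChain x + P.edgeChain (P.glue x) = 0 := by
  rw [edgeChain, edgeChain, ← map_add]
  exact (Submodule.Quotient.mk_eq_zero _).2 (Submodule.subset_span ⟨x, hx, rfl⟩)

open Classical in
/-- The coefficient of a side in a 1-chain. -/
noncomputable def edgeCoord (x : P.Side) : P.EdgeChains →ₗ[ℚ] ℚ :=
  P.glueRelations.liftQ
    -- Subtracting the coefficient of the partner makes the functional vanish on the gluing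
    -- relations.
    (Finsupp.lapply x - if P.glue x = x then 0 else Finsupp.lapply (P.glue x)) <| by
    refine Submodule.span_le.2 ?_
    rintro v ⟨y, hy, rfl⟩
    have hinj : ∀ a b, P.glue a = P.glue b → a = b := fun a b h => by
      rw [← P.glue_glue a, h, P.glue_glue]
    have h1 : P.glue y = x ↔ y = P.glue x :=
      ⟨fun h => by rw [← h, P.glue_glue], fun h => by rw [h, P.glue_glue]⟩
    have h2 : P.glue y = P.glue x ↔ y = x := ⟨hinj _ _, fun h => by rw [h]⟩
    by_cases hx : P.glue x = x
    · have h3 : y ≠ x := fun h => hy (by rw [h, hx])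
      have h4 : y ≠ P.glue x := by rwa [hx]
      simp [hx, h1, h3]
    · simp [hx, Finsupp.single_apply, h1, h2]
      ring

open Classical in
theorem edgeCoord_edgeChain (x y : P.Side) :
    edgeCoord x (P.edgeChain y) =
      (if y = x then 1 else 0) - if P.glue x = x then 0 else if y = P.glue x then 1 else 0 := by
  have h : edgeCoord x (P.edgeChain y) =
      (Finsupp.lapply x - if P.glue x = x then 0 else Finsupp.lapply (P.glue x) :
        (P.Side →₀ ℚ) →ₗ[ℚ] ℚ) (Finsupp.single y 1) := rfl
  rw [h]
  by_cases hx : P.glue x = x <;> simp [hx, Finsupp.single_apply]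

/-- Exactly the polygons on the two sides of an interior edge meet it, with opposite directions. For
a 2-cycle their coefficients hence agree. -/
theorem edgeCoord_cappedBoundaryTwo_of_glue_ne (x : P.Side) (hx : P.glue x ≠ x)
    (g : P.CappedFace →₀ ℚ) :
    edgeCoord x (P.cappedBoundaryTwo g) =
      g (Sum.inl (P.polygonOf x)) - g (Sum.inl (P.polygonOf (P.glue x))) := by
  classical
  have : (edgeCoord x).comp P.cappedBoundaryTwo =
      Finsupp.lapply (Sum.inl (P.polygonOf x)) -
        Finsupp.lapply (Sum.inl (P.polygonOf (P.glue x))) := by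
    ext (f | b)
    · simp [cappedBoundaryTwo, faceBoundary, edgeCoord_edgeChain, hx, Finsupp.single_apply,
        Finset.sum_sub_distrib, eq_comm]
    · have h1 : ∀ y : P.FreeSide, y.1 ≠ x := fun y h => hx (h ▸ y.2)
      have h2 : ∀ y : P.FreeSide, y.1 ≠ P.glue x := fun y h => hx (by
        have := y.2
        rw [h, P.glue_glue] at this
        exact this.symm)
      simp [cappedBoundaryTwo, faceBoundary, edgeCoord_edgeChain, hx, h1, h2]
  exact LinearMap.congr_fun this g

/-- A free edge lies between its polygon and one cap, so a 2-cycle has the same coefficient on both.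
-/
theorem edgeCoord_cappedBoundaryTwo_of_free (x : P.FreeSide) (g : P.CappedFace →₀ ℚ) :
    edgeCoord x.1 (P.cappedBoundaryTwo g) =
      g (Sum.inl (P.polygonOf x.1)) - g (Sum.inr (P.boundaryOf x)) := by
  classical
  have : (edgeCoord x.1).comp P.cappedBoundaryTwo =
      Finsupp.lapply (Sum.inl (P.polygonOf x.1)) - Finsupp.lapply (Sum.inr (P.boundaryOf x)) := by
    ext (f | b)
    · simp [cappedBoundaryTwo, faceBoundary, edgeCoord_edgeChain, x.2, Finsupp.single_apply,
        eq_comm]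
    · simp [cappedBoundaryTwo, faceBoundary, edgeCoord_edgeChain, x.2, Finsupp.single_apply,
        ← Subtype.ext_iff, eq_comm]
  exact LinearMap.congr_fun this g

/-- The sum of all faces is the fundamental cycle: glued sides cancel in pairs, and free sides
cancel against the caps. -/
theorem sum_faceBoundary [Fintype P.CappedFace] : ∑ f, P.faceBoundary f = 0 := by
  classical
  have := Fintype.ofFinite P.Polygon
  have := Fintype.ofFinite P.BoundaryComponent
  have h1 : ∑ f, P.faceBoundary (Sum.inl f) = ∑ x, P.edgeChain x := by
    simp only [faceBoundary]
    exact Finset.sum_fiberwise _ _ _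
  have h2 : ∑ b, P.faceBoundary (Sum.inr b) = -∑ x : P.FreeSide, P.edgeChain x.1 := by
    simp only [faceBoundary]
    rw [Finset.sum_neg_distrib]
    congr 1
    exact Finset.sum_fiberwise _ _ _
  have h3 : ∑ x with P.glue x ≠ x, P.edgeChain x = 0 := by
    refine Finset.sum_involution (fun x _ => P.glue x) ?_ ?_ ?_ ?_
    · exact fun x hx => edgeChain_glue x (Finset.mem_filter.1 hx).2
    · exact fun x hx _ => (Finset.mem_filter.1 hx).2
    · intro x hx
      simp only [Finset.mem_filter, Finset.mem_univ, true_and, P.glue_glue] at hx ⊢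
      exact hx.symm
    · exact fun x _ => P.glue_glue x
  have h4 : ∑ f, P.faceBoundary f = ∑ f, P.faceBoundary (Sum.inl f)
      + ∑ b, P.faceBoundary (Sum.inr b) := by
    rw [← Fintype.sum_sum_type]
    convert rfl
  have h5 := Finset.sum_filter_add_sum_filter_not Finset.univ (fun x => P.glue x = x) P.edgeChain
  rw [h4, h1, h2, ← h5, h3, ← Finset.sum_subtype_eq_sum_filter]
  simp

/-- This is `H₂ = ℚ`: the coefficients of a 2-cycle agree across every edge, so by connectedness it
is a multiple of the fundamental cycle `u`. -/
theorem finrank_range_cappedBoundaryTwo (hP : P.IsConnected) [Nonempty P.Side] :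
    Module.finrank ℚ (LinearMap.range P.cappedBoundaryTwo) + 1 =
      Nat.card P.Polygon + Nat.card P.BoundaryComponent := by
  have := Fintype.ofFinite P.CappedFace
  obtain ⟨x₀⟩ := ‹Nonempty P.Side›
  let u : P.CappedFace →₀ ℚ := ∑ f, Finsupp.single f 1
  have hu_apply : ∀ f, u f = 1 := by
    classical
    intro f
    simp [u, Finsupp.finsetSum_apply, Finsupp.single_apply]
  have hu : u ≠ 0 := fun h => by
    have := hu_apply (Sum.inl (P.polygonOf x₀))
    simp [h] at this
  have hker : LinearMap.ker P.cappedBoundaryTwo = Submodule.span ℚ {u} := by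
    apply le_antisymm
    · intro g hg
      have hg0 : P.cappedBoundaryTwo g = 0 := hg
      have hnext : ∀ x, g (Sum.inl (P.polygonOf (P.next x))) = g (Sum.inl (P.polygonOf x)) :=
        fun x => by rw [show P.polygonOf (P.next x) = P.polygonOf x from PermCycles.mk_apply _ x]
      have hglue : ∀ x, g (Sum.inl (P.polygonOf (P.glue x))) = g (Sum.inl (P.polygonOf x)) := by
        intro x
        by_cases hx : P.glue x = x
        · rw [hx]
        · have := edgeCoord_cappedBoundaryTwo_of_glue_ne x hx g
          rw [hg0, map_zero] at this
          linarith
      have hconst := hP _ (fun x => g (Sum.inl (P.polygonOf x))) hnext hglue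
      refine Submodule.mem_span_singleton.2 ⟨g (Sum.inl (P.polygonOf x₀)), ?_⟩
      ext f
      rw [Finsupp.smul_apply, hu_apply, smul_eq_mul, mul_one]
      rcases f with f | b
      · obtain ⟨x, rfl⟩ := Quot.exists_rep f
        exact hconst x₀ x
      · obtain ⟨x, rfl⟩ := Quot.exists_rep b
        have := edgeCoord_cappedBoundaryTwo_of_free x g
        rw [hg0, map_zero] at this
        rw [hconst x₀ x.1, ← sub_eq_zero]
        exact this.symm
    · rw [Submodule.span_singleton_le_iff_mem, LinearMap.mem_ker, map_sum]
      simpa [cappedBoundaryTwo] using P.sum_faceBoundary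
  have h := LinearMap.finrank_range_add_finrank_ker P.cappedBoundaryTwo
  rwa [hker, finrank_span_singleton hu, finrank_finsupp_eq_natCard, Nat.card_sum] at h

/-- The cellular chain complex condition, if `τ` sends every boundary side to its successor. -/
theorem range_cappedBoundaryTwo_le_ker (τ : Equiv.Perm P.FreeSide)
    (hτ : ∀ x, P.finish x.1 = P.start (τ x).1) :
    LinearMap.range P.cappedBoundaryTwo ≤ LinearMap.ker P.boundaryOne := by
  classical
  have hedge : ∀ x, P.boundaryOne (P.edgeChain x) =
      Finsupp.single (P.finish x) 1 - Finsupp.single (P.start x) 1 := by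
    intro x
    rw [boundaryOne, edgeChain, Submodule.mkQ_apply, Submodule.liftQ_apply]
    simp [sideBoundary]
  rw [LinearMap.range_le_ker_iff]
  ext1 f
  ext1
  rcases f with f | b
  · simp only [cappedBoundaryTwo, faceBoundary, LinearMap.comp_apply, Finsupp.lsingle_apply,
      Finsupp.linearCombination_single, one_smul, map_sum, hedge, LinearMap.zero_apply,
      Finset.sum_sub_distrib]
    rw [sub_eq_zero]
    -- Along a closed polygon the end points are the starting points shifted by one side. The caps
    -- are treated in the same way with `τ`.
    refine Finset.sum_equiv P.next (fun x => ?_) fun x _ => rfl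
    simp only [Finset.mem_filter, Finset.mem_univ, true_and]
    rw [show P.polygonOf (P.next x) = P.polygonOf x from PermCycles.mk_apply _ x]
  · simp only [cappedBoundaryTwo, faceBoundary, LinearMap.comp_apply, Finsupp.lsingle_apply,
      Finsupp.linearCombination_single, one_smul, map_neg, map_sum, hedge, LinearMap.zero_apply,
      Finset.sum_sub_distrib]
    rw [neg_eq_zero, sub_eq_zero]
    refine Finset.sum_equiv τ (fun x => ?_) fun x _ => by rw [hτ]
    simp only [Finset.mem_filter, Finset.mem_univ, true_and]
    rw [show P.boundaryOf (τ x) = P.boundaryOf x from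
      (Quot.sound (r := fun x y : P.FreeSide => P.finish x.1 = P.start y.1) (hτ x)).symm]

/-- The Euler characteristic of a connected capped surface. -/
theorem finrank_cappedHomologyOne (hP : P.IsConnected) [Nonempty P.Side]
    (τ : Equiv.Perm P.FreeSide) (hτ : ∀ x, P.finish x.1 = P.start (τ x).1) :
    Module.finrank ℚ P.CappedHomologyOne + Nat.card P.Vertex +
        (Nat.card P.Polygon + Nat.card P.BoundaryComponent) =
      Module.finrank ℚ P.EdgeChains + 2 := by
  have hle := range_cappedBoundaryTwo_le_ker τ hτ
  have h1 := finrank_range_boundaryOne hP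
  have h2 := finrank_range_cappedBoundaryTwo hP
  have h3 := LinearMap.finrank_range_add_finrank_ker P.boundaryOne
  have h4 := Submodule.finrank_quotient_add_finrank
    ((LinearMap.range P.cappedBoundaryTwo).submoduleOf (LinearMap.ker P.boundaryOne))
  rw [(Submodule.submoduleOfEquivOfLe hle).finrank_eq] at h4
  change Module.finrank ℚ P.CappedHomologyOne + _ = _ at h4
  omega

end PolygonSurface

/-! ### Vertices and polygons of the Seifert surface -/

namespace DiagramData

variable {D : DiagramData}

/-- The end of a crossing, or the circle without crossings, at which a side of the Seifert surface
starts. -/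
def corner : D.SeifertSide → D.HalfEdge ⊕ D.Circle
  | .arc (Sum.inl p) => Sum.inl (Sum.inl p)
  | .arc (Sum.inr o) => Sum.inr o
  | .smoothing p => Sum.inl (Sum.inr p)
  | .bandEnd p => Sum.inl (Sum.inl p)
  | .strand p => Sum.inl (Sum.inr p)

/-- Only the gluings of bands identify corners: `smoothing p` with `strand p` at the incoming end,
and `bandEnd p` with the outgoing arc at the outgoing end. -/
theorem corner_eq_of_glue : ∀ x y : D.SeifertSide,
    (SeifertSide.glue x ≠ x ∧ y = SeifertSide.next (SeifertSide.glue x)) → corner x = corner y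
  | .arc _, _, h => absurd rfl h.1
  | .strand _, _, h => absurd rfl h.1
  | .smoothing _, _, h => by rw [h.2]; rfl
  | .bandEnd _, _, h => by rw [h.2]; rfl

theorem start_smoothing (p : D.Crossing × Bool) :
    D.seifertSurface.start (.smoothing p) = D.seifertSurface.start (.strand p) :=
  D.seifertSurface.start_eq_finish_glue (SeifertSide.smoothing p) (fun h => nomatch h)

theorem start_bandEnd (p : D.Crossing × Bool) :
    D.seifertSurface.start (.bandEnd p) = D.seifertSurface.start (.arc (Sum.inl p)) :=
  D.seifertSurface.start_eq_finish_glue (SeifertSide.bandEnd p) (fun h => nomatch h)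

variable (D) in
/-- The vertices of the Seifert surface. -/
noncomputable def vertexEquiv : D.seifertSurface.Vertex ≃ D.HalfEdge ⊕ D.Circle where
  toFun := Quot.lift corner corner_eq_of_glue
  invFun
    | Sum.inl (Sum.inl p) => D.seifertSurface.start (.arc (Sum.inl p))
    | Sum.inl (Sum.inr p) => D.seifertSurface.start (.strand p)
    | Sum.inr o => D.seifertSurface.start (.arc (Sum.inr o))
  left_inv := by
    rintro ⟨(p | o) | p | p | p⟩
    · rfl
    · rfl
    · exact (start_smoothing p).symm
    · exact (start_bandEnd p).symm
    · rfl
  right_inv := by rintro ((p | p) | o) <;> rfl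

theorem corner_eq_of_start_eq {x y : D.SeifertSide}
    (h : D.seifertSurface.start x = D.seifertSurface.start y) : corner x = corner y :=
  congrArg (vertexEquiv D) h

/-- The disc or band to which a side belongs. -/
def patch : D.SeifertSide → D.SeifertCircle ⊕ D.Crossing
  | .arc a => Sum.inl (Quotient.mk _ a)
  | .smoothing p => Sum.inl (Quotient.mk _ (Sum.inl p))
  | .bandEnd p => Sum.inr p.1
  | .strand p => Sum.inr p.1

theorem patch_next : ∀ x : D.SeifertSide, patch (SeifertSide.next x) = patch x
  | .arc (Sum.inl p) => congrArg Sum.inl (PermCycles.mk_apply D.smoothNext (Sum.inl p))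
  | .arc (Sum.inr _) => rfl
  | .smoothing _ => rfl
  | .bandEnd _ => rfl
  | .strand _ => rfl

theorem polygonOf_next (x : D.SeifertSide) :
    D.seifertSurface.polygonOf (SeifertSide.next x) = D.seifertSurface.polygonOf x :=
  PermCycles.mk_apply D.seifertSurface.next x

theorem polygonOf_arc_smoothNext : ∀ a : D.Arc,
    D.seifertSurface.polygonOf (.arc (D.smoothNext a)) = D.seifertSurface.polygonOf (.arc a)
  | Sum.inl p => (polygonOf_next (.smoothing (D.edge p))).trans (polygonOf_next (.arc (Sum.inl p)))
  | Sum.inr _ => rfl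

theorem polygonOf_bandEnd_swapSides (p : D.Crossing × Bool) :
    D.seifertSurface.polygonOf (.bandEnd (D.swapSides p)) =
      D.seifertSurface.polygonOf (.bandEnd p) :=
  (polygonOf_next (.strand p)).trans (polygonOf_next (.bandEnd p))

theorem polygonOf_bandEnd (x : D.Crossing) : ∀ b,
    D.seifertSurface.polygonOf (.bandEnd (x, false)) = D.seifertSurface.polygonOf (.bandEnd (x, b))
  | false => rfl
  | true => polygonOf_bandEnd_swapSides (x, true)

variable (D) in
/-- The polygons of the Seifert surface are one disc for every Seifert circle and one band for
every crossing. -/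
noncomputable def polygonEquiv : D.seifertSurface.Polygon ≃ D.SeifertCircle ⊕ D.Crossing where
  toFun := PermCycles.lift patch patch_next
  invFun := Sum.elim
    (PermCycles.lift (fun a => D.seifertSurface.polygonOf (.arc a)) polygonOf_arc_smoothNext)
    fun x => D.seifertSurface.polygonOf (.bandEnd (x, false))
  left_inv := by
    rintro ⟨a | p | p | p⟩
    · rfl
    · exact polygonOf_next (.smoothing p)
    · exact polygonOf_bandEnd p.1 p.2
    · exact (polygonOf_bandEnd p.1 p.2).trans (polygonOf_next (.bandEnd p)).symm
  right_inv := by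
    rintro (a | x)
    · obtain ⟨a, rfl⟩ := Quot.exists_rep a
      rfl
    · rfl

/-! ### Boundary of the Seifert surface -/

variable (D) in
/-- The successor of a free side on the boundary of the Seifert surface; the other sides are
fixed. -/
def boundaryNext : Equiv.Perm D.SeifertSide where
  toFun
    | .arc (Sum.inl p) => .strand (D.edge p)
    | .arc (Sum.inr o) => .arc (Sum.inr o)
    | .strand p => .arc (Sum.inl (D.swapSides p))
    | .smoothing p => .smoothing p
    | .bandEnd p => .bandEnd p
  invFun
    | .strand p => .arc (Sum.inl (D.edge.symm p))
    | .arc (Sum.inr o) => .arc (Sum.inr o)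
    | .arc (Sum.inl p) => .strand (D.swapSides.symm p)
    | .smoothing p => .smoothing p
    | .bandEnd p => .bandEnd p
  left_inv x := by rcases x with (p | o) | p | p | p <;> simp
  right_inv x := by rcases x with (p | o) | p | p | p <;> simp

theorem glue_boundaryNext : ∀ x : D.SeifertSide,
    SeifertSide.glue (D.boundaryNext x) = D.boundaryNext x ↔ SeifertSide.glue x = x
  | .arc (Sum.inl _) => ⟨fun _ => rfl, fun _ => rfl⟩
  | .arc (Sum.inr _) => Iff.rfl
  | .strand _ => ⟨fun _ => rfl, fun _ => rfl⟩
  | .smoothing _ => Iff.rfl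
  | .bandEnd _ => Iff.rfl

variable (D) in
/-- The successor of a free side on the boundary of the Seifert surface. -/
def freeNext : Equiv.Perm D.seifertSurface.FreeSide :=
  Equiv.Perm.subtypePerm (p := fun x : D.SeifertSide => SeifertSide.glue x = x) D.boundaryNext
    glue_boundaryNext

theorem finish_eq_start_freeNext : ∀ x : D.seifertSurface.FreeSide,
    D.seifertSurface.finish x.1 = D.seifertSurface.start (D.freeNext x).1
  | ⟨.arc (Sum.inl p), _⟩ => start_smoothing (D.edge p)
  | ⟨.arc (Sum.inr _), _⟩ => rfl
  | ⟨.strand p, _⟩ => start_bandEnd (D.swapSides p)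
  | ⟨.smoothing _, h⟩ => nomatch h
  | ⟨.bandEnd _, h⟩ => nomatch h

theorem boundaryOf_freeNext (x : D.seifertSurface.FreeSide) :
    D.seifertSurface.boundaryOf (D.freeNext x) = D.seifertSurface.boundaryOf x :=
  (Quot.sound (r := fun x y : D.seifertSurface.FreeSide =>
    D.seifertSurface.finish x.1 = D.seifertSurface.start y.1) (finish_eq_start_freeNext x)).symm

/-- An arc of the diagram, as a boundary side of the Seifert surface. -/
def freeArc (a : D.Arc) : D.seifertSurface.FreeSide := ⟨SeifertSide.arc a, rfl⟩

/-- The component of the link that contains a free side; the other sides have an arbitrary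
value. -/
def componentOf : D.SeifertSide → D.Component
  | .arc a => Quotient.mk _ a
  | .strand p => Quotient.mk _ (Sum.inl (D.swapSides p))
  | .smoothing p => Quotient.mk _ (Sum.inl p)
  | .bandEnd p => Quotient.mk _ (Sum.inl p)

theorem componentOf_boundaryNext : ∀ x : D.SeifertSide,
    componentOf (D.boundaryNext x) = componentOf x
  | .arc (Sum.inl p) => PermCycles.mk_apply D.linkNext (Sum.inl p)
  | .arc (Sum.inr _) => rfl
  | .strand _ => rfl
  | .smoothing _ => rfl
  | .bandEnd _ => rfl

/-- No two free sides start at the same vertex. Hence the successor of a boundary side is unique,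
and the relation that defines boundary components is the graph of `freeNext`. -/
theorem eq_of_corner_eq : ∀ x y : D.SeifertSide, SeifertSide.glue x = x → SeifertSide.glue y = y →
    corner x = corner y → x = y := by
  rintro ((p | o) | p | p | p) ((q | o') | q | q | q) hx hy h <;>
    simp_all [corner, SeifertSide.glue]

theorem componentOf_eq (x y : D.seifertSurface.FreeSide)
    (h : D.seifertSurface.finish x.1 = D.seifertSurface.start y.1) :
    componentOf x.1 = componentOf y.1 := by
  have hxy : (D.freeNext x).1 = y.1 := eq_of_corner_eq _ _ (D.freeNext x).2 y.2
    (corner_eq_of_start_eq ((finish_eq_start_freeNext x).symm.trans h))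
  exact (componentOf_boundaryNext x.1).symm.trans (congrArg componentOf hxy)

/-- Going straight on through a crossing takes two boundary steps: from the arc to a strand of the
band, then to the next arc. -/
theorem boundaryOf_freeArc_linkNext : ∀ a : D.Arc,
    D.seifertSurface.boundaryOf (freeArc (D.linkNext a)) = D.seifertSurface.boundaryOf (freeArc a)
  | Sum.inl p => (boundaryOf_freeNext (D.freeNext (freeArc (Sum.inl p)))).trans
      (boundaryOf_freeNext (freeArc (Sum.inl p)))
  | Sum.inr _ => rfl

variable (D) in
/-- The boundary of the Seifert surface is the link. -/
noncomputable def boundaryEquiv : D.seifertSurface.BoundaryComponent ≃ D.Component where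
  toFun := Quot.lift (fun x => componentOf x.1) componentOf_eq
  invFun := PermCycles.lift (fun a => D.seifertSurface.boundaryOf (freeArc a))
    boundaryOf_freeArc_linkNext
  left_inv := by
    rintro ⟨a | p | p | p, h⟩
    · rfl
    · exact nomatch h
    · exact nomatch h
    · exact boundaryOf_freeNext ⟨SeifertSide.strand p, h⟩
  right_inv := by rintro ⟨a⟩; rfl

/-! ### Edges of the Seifert surface -/

variable (D) in
/-- The edges of the Seifert surface. -/
abbrev SeifertEdge : Type := D.Arc ⊕ (D.Crossing × Bool) ⊕ (D.Crossing × Bool)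

/-- A side of the Seifert surface, as an oriented edge. -/
noncomputable def sideEdge : D.SeifertSide → (D.SeifertEdge →₀ ℚ)
  | .arc a => Finsupp.single (Sum.inl a) 1
  | .smoothing p => Finsupp.single (Sum.inr (Sum.inl p)) 1
  | .bandEnd p => -Finsupp.single (Sum.inr (Sum.inl p)) 1
  | .strand p => Finsupp.single (Sum.inr (Sum.inr p)) 1

theorem sideEdge_add_glue : ∀ x : D.SeifertSide, SeifertSide.glue x ≠ x →
    sideEdge x + sideEdge (SeifertSide.glue x) = 0
  | .arc _, h => absurd rfl h
  | .strand _, h => absurd rfl h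
  | .smoothing _, _ => add_neg_cancel _
  | .bandEnd _, _ => neg_add_cancel _

/-- A side that represents an edge of the Seifert surface. -/
def edgeSide : D.SeifertEdge → D.SeifertSide
  | Sum.inl a => .arc a
  | Sum.inr (Sum.inl p) => .smoothing p
  | Sum.inr (Sum.inr p) => .strand p

theorem sideEdge_edgeSide (e : D.SeifertEdge) : sideEdge (edgeSide e) = Finsupp.single e 1 := by
  rcases e with a | p | p <;> rfl

variable (D) in
/-- The 1-chains of the Seifert surface, written in terms of the edges. -/
noncomputable def edgeChainsToFinsupp :
    D.seifertSurface.EdgeChains →ₗ[ℚ] (D.SeifertEdge →₀ ℚ) :=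
  D.seifertSurface.glueRelations.liftQ
    (Finsupp.linearCombination ℚ fun x : D.seifertSurface.Side => sideEdge x) <| by
    refine Submodule.span_le.2 ?_
    rintro v ⟨x, hx, rfl⟩
    rw [SetLike.mem_coe, LinearMap.mem_ker, map_add, Finsupp.linearCombination_single,
      Finsupp.linearCombination_single, one_smul,
      one_smul]
    exact sideEdge_add_glue x hx

theorem edgeChainsToFinsupp_edgeChain (x : D.SeifertSide) :
    D.edgeChainsToFinsupp (D.seifertSurface.edgeChain x) = sideEdge x :=
  (Finsupp.linearCombination_single ℚ (1 : ℚ) (v := fun x : D.seifertSurface.Side => sideEdge x)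
    x).trans (one_smul ℚ _)

variable (D) in
/-- The 1-chain of a combination of edges of the Seifert surface. -/
noncomputable def edgeChainsOfFinsupp :
    (D.SeifertEdge →₀ ℚ) →ₗ[ℚ] D.seifertSurface.EdgeChains :=
  Finsupp.linearCombination ℚ fun e => D.seifertSurface.edgeChain (edgeSide e)

theorem edgeChainsOfFinsupp_sideEdge : ∀ x : D.SeifertSide,
    D.edgeChainsOfFinsupp (sideEdge x) = D.seifertSurface.edgeChain x
  | .arc a => by simp [sideEdge, edgeChainsOfFinsupp, edgeSide]
  | .strand a => by simp [sideEdge, edgeChainsOfFinsupp, edgeSide]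
  | .smoothing a => by simp [sideEdge, edgeChainsOfFinsupp, edgeSide]
  | .bandEnd p => by
    have h : D.seifertSurface.edgeChain (.bandEnd p) + D.seifertSurface.edgeChain (.smoothing p) =
        0 := PolygonSurface.edgeChain_glue (P := D.seifertSurface) (SeifertSide.bandEnd p)
      (fun h => nomatch h)
    simpa [sideEdge, edgeChainsOfFinsupp, edgeSide] using (eq_neg_of_add_eq_zero_left h).symm

variable (D) in
theorem finrank_edgeChains :
    Module.finrank ℚ D.seifertSurface.EdgeChains = Nat.card D.SeifertEdge := by
  rw [← PolygonSurface.finrank_finsupp_eq_natCard]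
  refine (LinearEquiv.ofLinearMap D.edgeChainsToFinsupp D.edgeChainsOfFinsupp ?_ ?_).finrank_eq
  · refine Finsupp.lhom_ext' fun e => LinearMap.ext_ring ?_
    rw [LinearMap.comp_apply, LinearMap.comp_apply, Finsupp.lsingle_apply, edgeChainsOfFinsupp,
      Finsupp.linearCombination_single, one_smul, edgeChainsToFinsupp_edgeChain, sideEdge_edgeSide]
    rfl
  · refine Submodule.linearMap_qext _ (Finsupp.lhom_ext' fun x => LinearMap.ext_ring ?_)
    exact (congrArg D.edgeChainsOfFinsupp (edgeChainsToFinsupp_edgeChain x)).trans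
      (edgeChainsOfFinsupp_sideEdge x)

/-! ### Connectedness and the rank of the homology -/

/-- The piece of the diagram to which a side of the Seifert surface belongs. -/
def pieceOf : D.SeifertSide → D.Piece
  | .arc (Sum.inl p) => Sum.inl (Quot.mk _ p.1)
  | .arc (Sum.inr o) => Sum.inr o
  | .smoothing p => Sum.inl (Quot.mk _ p.1)
  | .bandEnd p => Sum.inl (Quot.mk _ p.1)
  | .strand p => Sum.inl (Quot.mk _ p.1)

/-- The Seifert surface of a connected diagram is connected. -/
theorem seifertSurface_isConnected (hD : D.IsConnected) : D.seifertSurface.IsConnected := by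
  intro M h hnext hglue
  have hsub : Subsingleton D.Piece := (Nat.card_eq_one_iff_unique.1 hD).1
  have hstrand (p) : h (SeifertSide.strand p) = h (SeifertSide.bandEnd p) :=
    hnext (SeifertSide.bandEnd p)
  have hswap (p) : h (SeifertSide.bandEnd (D.swapSides p)) = h (SeifertSide.bandEnd p) :=
    (hnext (SeifertSide.strand p)).trans (hstrand p)
  have hband (x : D.Crossing) (b : Bool) :
      h (SeifertSide.bandEnd (x, b)) = h (SeifertSide.bandEnd (x, false)) := by
    cases b with
    | false => rfl
    | true => exact hswap (x, false)
  have hsmooth (p) : h (SeifertSide.smoothing p) = h (SeifertSide.bandEnd p) :=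
    hglue (SeifertSide.bandEnd p)
  have harc (p) : h (SeifertSide.arc (Sum.inl p)) = h (SeifertSide.bandEnd p) :=
    (hnext (SeifertSide.smoothing p)).trans (hsmooth p)
  have hedge (p) : h (SeifertSide.bandEnd (D.edge p)) = h (SeifertSide.bandEnd p) :=
    (hsmooth _).symm.trans ((hnext (SeifertSide.arc (Sum.inl p))).trans (harc p))
  -- An invariant function takes one value on each band, and `hedge` equates the values at adjacent
  -- crossings; it therefore factors through the pieces.
  let k : D.Piece → M := Sum.elim
    (Quot.lift (fun x => h (SeifertSide.bandEnd (x, false))) (by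
      rintro x y ⟨a, b, hab⟩
      have := hedge (x, a)
      rw [hab, hband, hband x] at this
      exact this.symm))
    fun o => h (SeifertSide.arc (Sum.inr o))
  have hk : ∀ x : D.SeifertSide, h x = k (pieceOf x) := by
    rintro ((p | o) | p | p | p)
    · exact (harc p).trans (hband p.1 p.2)
    · rfl
    · exact (hsmooth p).trans (hband p.1 p.2)
    · exact hband p.1 p.2
    · exact (hstrand p).trans (hband p.1 p.2)
  intro x y
  rw [hk x, hk y, Subsingleton.elim (pieceOf x) (pieceOf y)]

theorem nonempty_side (hD : D.IsConnected) : Nonempty D.seifertSurface.Side := by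
  obtain ⟨x | o⟩ := (Nat.card_eq_one_iff_unique.1 hD).2
  · obtain ⟨x, rfl⟩ := Quot.exists_rep x
    exact ⟨SeifertSide.arc (Sum.inl (x, false))⟩
  · exact ⟨SeifertSide.arc (Sum.inr o)⟩

/-- The rank of the first homology of the capped Seifert surface. -/
theorem finrank_cappedHomologyOne (hD : D.IsConnected) :
    Module.finrank ℚ D.seifertSurface.CappedHomologyOne + D.numSeifertCircles + D.numComponents =
      D.numCrossings + 2 := by
  have := nonempty_side hD
  have h := PolygonSurface.finrank_cappedHomologyOne (seifertSurface_isConnected hD) D.freeNext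
    finish_eq_start_freeNext
  rw [finrank_edgeChains, Nat.card_congr D.vertexEquiv, Nat.card_congr D.polygonEquiv,
    Nat.card_congr D.boundaryEquiv] at h
  -- The counts become `4c + o` vertices, `s + c` polygons, `μ` caps and `6c + o` edges; the circles
  -- cancel.
  simp only [Nat.card_sum, Nat.card_prod, Nat.card_eq_fintype_card (α := Bool),
    Fintype.card_bool] at h
  rw [numSeifertCircles, numComponents, numCrossings]
  omega

/-! ### Parity of the number of link components -/

theorem sign_swapSides [DecidableEq D.Crossing] :
    Equiv.Perm.sign D.swapSides = (-1) ^ D.numCrossings := by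
  have h : D.swapSides = Equiv.prodCongrRight fun _ => Equiv.swap false true := by
    ext ⟨x, b⟩ <;> cases b <;> rfl
  rw [h, Equiv.Perm.sign_prodCongrRight]
  simp [numCrossings]

/-- Every crossing changes the parity of the number of closed curves if it is smoothed. -/
theorem even_numComponents_add (D : DiagramData) :
    Even (D.numComponents + D.numSeifertCircles + D.numCrossings) := by
  classical
  have h1 := PermCycles.sign_eq D.linkNext
  have h2 := PermCycles.sign_eq D.smoothNext
  rw [linkNext, Equiv.Perm.sign_sumCongr, Equiv.Perm.sign_trans, sign_swapSides] at h1
  rw [smoothNext, Equiv.Perm.sign_sumCongr] at h2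
  -- Both permutations act on the same set of arcs, so its cardinality cancels from the two sign
  -- formulas.
  have h3 : (-1 : ℤˣ) ^ D.numCrossings * (-1) ^ (Fintype.card D.Arc + D.numSeifertCircles) =
      (-1) ^ (Fintype.card D.Arc + D.numComponents) :=
    (congrArg _ h2.symm).trans ((mul_assoc _ _ _).symm.trans h1)
  have h4 : (-1 : ℤˣ) ^ (D.numComponents + D.numSeifertCircles + D.numCrossings) = 1 := by
    rw [pow_add, pow_add] at h3
    have h5 : (-1 : ℤˣ) ^ D.numCrossings * (-1) ^ D.numSeifertCircles = (-1) ^ D.numComponents := by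
      rw [mul_left_comm] at h3
      exact mul_left_cancel h3
    rw [pow_add, pow_add, mul_assoc, mul_comm ((-1) ^ D.numSeifertCircles), h5, ← pow_two,
      Int.units_sq]
  rwa [neg_one_pow_eq_one_iff_even (by decide)] at h4

end DiagramData

theorem mainTheorem7 (K : LinkDiagram) (hK : K.IsConnected) :
    (K.seifertSurface.genus : ℚ) =
      ((K.numCrossings : ℚ) - K.numSeifertCircles + 1 - ((K.numComponents : ℚ) - 1)) / 2 := by
  have h := DiagramData.finrank_cappedHomologyOne hK
  obtain ⟨m, hm⟩ := K.even_numComponents_add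
  -- By `hm` the rank `c + 2 - s - μ` is even, so the division by two in `genus` is exact.
  have hg : 2 * K.seifertSurface.genus + K.numSeifertCircles + K.numComponents =
      K.numCrossings + 2 := by
    rw [PolygonSurface.genus]
    omega
  have hq : 2 * (K.seifertSurface.genus : ℚ) + K.numSeifertCircles + K.numComponents =
      K.numCrossings + 2 := by exact_mod_cast hg
  linarith
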